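/- Let $V$ be a finite set with $|V|\ge 3$, let $G\le \mathrm{Sym}(V)$ be a transitive permutation group, and let $n\ge 2$. Let $G^n=G\times\cdots\times G$ ($n$ factors) be the internal direct product, that is, the direct product acting on the disjoint union of $n$ copies of $V$, with the $i$-th factor acting on the $i$-th copy: $(g_1,\dots,g_n)$ maps the point $x$ of the $i$-th copy to the point $g_i(x)$ of the $i$-th copy. Then $G^n$ has the strict-EKR-property if and only if $G$ has the strict-EKR-property and the derangement graph $\Gamma_G$ is IS-primitive. Here a subset $I$ of a permutation group $P$ is *intersecting* if for all $g,h\in I$ there is a point $v$ with $g(v)=h(v)$; $P$ has the *strict-EKR-property* if every intersecting set of maximum size in $P$ is a coset of a point stabilizer. The *derangement graph* $\Gamma_G$ has vertex set $G$, with $g$ and $h$ adjacent if and only if $gh^{-1}$ has no fixed point. A finite graph $\Gamma$ is *IS-primitive* if there is no nonempty independent set $A$ with $|A|<\alpha(\Gamma)$ and $|A|/|N[A]|=\alpha(\Gamma)/|V(\Gamma)|$, where $N[A]$ is the closed neighbourhood of $A$ and $\alpha(\Gamma)$ is the independence number. -/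

import Mathlib

open scoped Pointwise

/-- The derangement graph `Γ_G` of a permutation group `G ≤ Sym(V)`: the vertices are the elements
of `G`, and `g`, `h` are adjacent when `g * h⁻¹` is a derangement. (The clause `g ≠ h` follows from
the other one as soon as `V` is nonempty.) -/
def derangementGraph {V : Type*} (G : Subgroup (Equiv.Perm V)) : SimpleGraph G where
  Adj g h := g ≠ h ∧ ((g * h⁻¹ : G) : Equiv.Perm V) ∈ derangements V
  symm := ⟨by
    rintro g h ⟨hne, hd⟩
    refine ⟨hne.symm, fun v hv => hd v ?_⟩
    have e : (g * h⁻¹ : G) = (h * g⁻¹)⁻¹ := by group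
    rw [e, Subgroup.coe_inv, Equiv.Perm.inv_eq_iff_eq]
    exact hv.symm⟩
  loopless := ⟨fun _ h => h.1 rfl⟩

/-- A subset `I` of `G` is intersecting if any two of its elements agree at some point. -/
def IsIntersecting {V : Type*} {G : Subgroup (Equiv.Perm V)} (I : Set G) : Prop :=
  ∀ g ∈ I, ∀ h ∈ I, ∃ v : V, (g : Equiv.Perm V) v = (h : Equiv.Perm V) v

/-- An intersecting set of maximum size (meant for finite `V`). -/
def IsMaximumIntersecting {V : Type*} {G : Subgroup (Equiv.Perm V)} (I : Set G) : Prop :=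
  IsIntersecting I ∧ ∀ J : Set G, IsIntersecting J → J.ncard ≤ I.ncard

/-- `G` has the strict-EKR-property: every maximum intersecting set is a coset `g G_v` of a point
stabilizer. (As `G_v g = g G_w` with `w = g⁻¹ v`, left and right cosets give the same sets.) -/
def StrictEKR {V : Type*} (G : Subgroup (Equiv.Perm V)) : Prop :=
  ∀ I : Set G, IsMaximumIntersecting I →
    ∃ (g : G) (v : V), I = g • (MulAction.stabilizer G v : Set G)

/-- The closed neighbourhood `N[A]` of a set of vertices. -/
def closedNeighborhood {W : Type*} (Γ : SimpleGraph W) (A : Set W) : Set W :=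
  A ∪ {w | ∃ a ∈ A, Γ.Adj a w}

/-- A finite graph `Γ` is IS-primitive if no (nonempty) independent set `A` which is not maximum,
i.e. `|A| < α(Γ)`, satisfies `|A| / |N[A]| = α(Γ) / |V(Γ)|`. -/
def ISPrimitive {W : Type*} (Γ : SimpleGraph W) : Prop :=
  ¬ ∃ A : Set W, A.Nonempty ∧ Γ.IsIndepSet A ∧ A.ncard < Γ.indepNum ∧
    (A.ncard : ℚ) / ((closedNeighborhood Γ A).ncard : ℚ) = (Γ.indepNum : ℚ) / (Nat.card W : ℚ)

/-- The internal direct product of permutation groups `G i ≤ Sym(V i)`: the direct product of the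
`G i` as a permutation group on the disjoint union of the `V i`, where `(g i)_i` maps a point `x`
of `V i` to `g i x`. -/
def internalDirectProduct {ι : Type*} {V : ι → Type*} (G : ∀ i, Subgroup (Equiv.Perm (V i))) :
    Subgroup (Equiv.Perm (Σ i, V i)) :=
  (Subgroup.pi Set.univ G).map (Equiv.Perm.sigmaCongrRightHom V)

/-! Intersecting sets are the independent sets of the derangement graph Γ of G. Two tuples disagree
at every point exactly when they do so in every coordinate, so the derangement graph of G^n is the
n-th direct (tensor) power of Γ. Put k = |V|. By transitivity g ↦ g v is a proper colouring of Γ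
with k classes of equal size, and strict EKR (for G or for G^n) makes these classes maximum. Hence
α(Γ)/|G| = 1/k, and IS-primitivity says that a nonempty independent A with k|A| = |N[A]| is maximum;
`BalancedPrimitive` abstracts this situation.

"If": exchanging against colour classes gives k|A| ≤ |N[A]|. An independent set of a product splits
into the isolated and the non-isolated points of its fibres, whose neighbourhoods do not overlap.
This bounds its size, and equality forces it to come from one factor
(`IndepFor.eq_prod_of_card_eq`). For k ≥ 3 the product is again primitive (`prod_prim`); for k = 2
this fails, K₂ × K₂ being disconnected. By induction a maximum independent set of a power is read
off from a single coordinate, where strict EKR for G applies.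

"Only if": cylinders over one coordinate carry bounds and cosets back to G. A set A violating
primitivity yields the maximum independent set {f 0 ∈ A} ∪ {f 0 ∉ N[A], f 1 ∈ T}, with T a point
stabilizer; it depends on two coordinates, so it is not a coset. -/

/-- No two elements of `A` are related by `r`. -/
def IndepFor {W : Type*} (r : W → W → Prop) (A : Finset W) : Prop :=
  ∀ a ∈ A, ∀ b ∈ A, ¬ r a b

theorem IndepFor.subset {W : Type*} {r : W → W → Prop} {A B : Finset W}
    (hB : IndepFor r B) (h : A ⊆ B) : IndepFor r A :=
  fun a ha b hb => hB a (h ha) b (h hb)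

open Classical in
/-- The closed neighbourhood of a finset with respect to a relation. -/
noncomputable def closedNbhd {W : Type*} [Fintype W] (r : W → W → Prop) (A : Finset W) :
    Finset W :=
  Finset.univ.filter fun w => w ∈ A ∨ ∃ a ∈ A, r a w

/-- A symmetric relation with a proper colouring by `k` colours whose classes are maximum
independent sets of equal size, and such that every nonempty independent set `A` with
`k |A| = |N[A]|` is maximum. -/
structure BalancedPrimitive {W : Type*} [Fintype W] (k : ℕ) (r : W → W → Prop) : Prop where
  symm : ∀ a b, r a b → r b a
  bound : ∀ A : Finset W, IndepFor r A → k * A.card ≤ Fintype.card W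
  color : ∃ c : W → Fin k, (∀ a b, r a b → c a ≠ c b) ∧
    ∀ i, k * (Finset.univ.filter fun w => c w = i).card = Fintype.card W
  prim : ∀ A : Finset W, IndepFor r A → A.Nonempty → k * A.card = (closedNbhd r A).card →
    k * A.card = Fintype.card W

/-! ### Independent sets against closed neighbourhoods; connectedness -/

section Basic

variable {W : Type*} [Fintype W] {k : ℕ} {r : W → W → Prop}

theorem mem_closedNbhd {A : Finset W} {w : W} :
    w ∈ closedNbhd r A ↔ w ∈ A ∨ ∃ a ∈ A, r a w := by
  simp [closedNbhd]

theorem subset_closedNbhd (A : Finset W) : A ⊆ closedNbhd r A :=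
  fun _ h => mem_closedNbhd.2 (Or.inl h)

theorem card_eq_sum_color [DecidableEq W] (c : W → Fin k) (K : Finset W) :
    K.card = ∑ i, ((Finset.univ.filter fun w => c w = i) ∩ K).card := by
  rw [Finset.card_eq_sum_card_fiberwise (f := c) (t := Finset.univ) (fun _ _ => Finset.mem_univ _)]
  refine Finset.sum_congr rfl fun i _ => congrArg _ ?_
  ext w
  simp [and_comm]

theorem indepFor_color {c : W → Fin k} (hc : ∀ a b, r a b → c a ≠ c b) (i : Fin k) :
    IndepFor r (Finset.univ.filter fun w => c w = i) := by
  intro a ha b hb hab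
  simp only [Finset.mem_filter, Finset.mem_univ, true_and] at ha hb
  exact hc a b hab (ha.trans hb.symm)

/-- Trading `T ∩ N[A]` for `A` keeps independence, so a maximum `T` must satisfy |A| ≤ |T ∩ N[A]|.
-/
theorem IndepFor.exchange [DecidableEq W] (hs : ∀ a b, r a b → r b a) {A T : Finset W}
    (hA : IndepFor r A) (hT : IndepFor r T) : IndepFor r (A ∪ (T \ closedNbhd r A)) := by
  intro a ha b hb hab
  simp only [Finset.mem_union, Finset.mem_sdiff, mem_closedNbhd, not_or, not_exists,
    not_and] at ha hb
  rcases ha with ha | ha <;> rcases hb with hb | hb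
  · exact hA a ha b hb hab
  · exact hb.2.2 a ha hab
  · exact ha.2.2 b hb (hs _ _ hab)
  · exact hT a ha.1 b hb.1 hab

theorem card_exchange [DecidableEq W] (A T : Finset W) :
    (A ∪ (T \ closedNbhd r A)).card + (T ∩ closedNbhd r A).card = A.card + T.card := by
  rw [Finset.card_union_of_disjoint]
  · have := Finset.card_sdiff_add_card_inter T (closedNbhd r A)
    omega
  · rw [Finset.disjoint_left]
    intro a ha h
    exact (Finset.mem_sdiff.1 h).2 (subset_closedNbhd A ha)

namespace BalancedPrimitive

variable (h : BalancedPrimitive k r)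
include h

theorem irrefl (a : W) : ¬ r a a := by
  obtain ⟨c, hc, -⟩ := h.color
  exact fun ha => hc a a ha rfl

theorem card_le_inter [DecidableEq W] (hk : 0 < k) {A T : Finset W} (hA : IndepFor r A)
    (hT : IndepFor r T) (hTc : k * T.card = Fintype.card W) :
    A.card ≤ (T ∩ closedNbhd r A).card := by
  have h1 := h.bound _ (hA.exchange h.symm hT)
  have h2 := card_exchange (r := r) A T
  rw [← hTc] at h1
  have h3 := Nat.le_of_mul_le_mul_left h1 hk
  omega

/-- Each of the k colour classes is maximum, so each meets `N[A]` in at least |A| points. -/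
theorem le_card_closedNbhd (hk : 0 < k) {A : Finset W} (hA : IndepFor r A) :
    k * A.card ≤ (closedNbhd r A).card := by
  classical
  obtain ⟨c, hc, hb⟩ := h.color
  rw [card_eq_sum_color c (closedNbhd r A)]
  calc k * A.card = ∑ _i : Fin k, A.card := by simp
    _ ≤ _ := Finset.sum_le_sum fun i _ =>
      h.card_le_inter hk hA (indepFor_color hc i) (hb i)

theorem exists_neighbor (hk : 2 ≤ k) (y : W) : ∃ z, r y z := by
  by_contra! hn
  have hi : IndepFor r {y} := by
    intro a ha b hb
    rw [Finset.mem_singleton] at ha hb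
    subst ha hb
    exact h.irrefl _
  have h1 := h.le_card_closedNbhd (by omega) hi
  have h2 : closedNbhd r {y} = {y} := by
    ext w
    simp [mem_closedNbhd, hn]
  rw [h2, Finset.card_singleton] at h1
  omega

/-- The graph is connected: a nonempty set closed under adjacency is everything. -/
theorem eq_univ_of_closed (hk : 0 < k) {K : Finset W} (hK : K.Nonempty)
    (hcl : ∀ a ∈ K, ∀ b, r a b → b ∈ K) : K = Finset.univ := by
  classical
  obtain ⟨c, hc, hb⟩ := h.color
  set T : Fin k → Finset W := fun i => Finset.univ.filter fun w => c w = i with hT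
  -- No edge leaves `K`, so the part of one colour class inside `K` can be glued to the part of
  -- another outside `K`. Hence all colours occur equally often in `K`.
  have hle : ∀ i j, (T i ∩ K).card ≤ (T j ∩ K).card := by
    intro i j
    have hI : IndepFor r ((T i ∩ K) ∪ (T j \ K)) := by
      intro a ha b hb' hab
      simp only [Finset.mem_union, Finset.mem_inter, Finset.mem_sdiff] at ha hb'
      rcases ha with ha | ha <;> rcases hb' with hb' | hb'
      · exact indepFor_color hc i a ha.1 b hb'.1 hab
      · exact hb'.2 (hcl a ha.2 b hab)
      · exact ha.2 (hcl b hb'.2 a (h.symm _ _ hab))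
      · exact indepFor_color hc j a ha.1 b hb'.1 hab
    have h1 := h.bound _ hI
    rw [← hb j] at h1
    have h2 := Nat.le_of_mul_le_mul_left h1 hk
    rw [Finset.card_union_of_disjoint] at h2
    · have h3 := Finset.card_sdiff_add_card_inter (T j) K
      have h4 : (T j).card = (Finset.univ.filter fun w => c w = j).card := rfl
      omega
    · rw [Finset.disjoint_left]
      intro a ha h'
      exact (Finset.mem_sdiff.1 h').2 (Finset.mem_inter.1 ha).2
  obtain ⟨x, hx⟩ := hK
  have hKc : K.card = k * (T (c x) ∩ K).card := by
    rw [card_eq_sum_color c K]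
    calc _ = ∑ _j : Fin k, (T (c x) ∩ K).card :=
          Finset.sum_congr rfl fun j _ => le_antisymm (hle _ _) (hle _ _)
      _ = _ := by simp
  have hI : IndepFor r (T (c x) ∩ K) := (indepFor_color hc _).subset Finset.inter_subset_left
  have hsub : closedNbhd r (T (c x) ∩ K) ⊆ K := by
    intro w hw
    rcases mem_closedNbhd.1 hw with hw | ⟨a, ha, haw⟩
    · exact (Finset.mem_inter.1 hw).2
    · exact hcl a (Finset.mem_inter.1 ha).2 w haw
  -- The neighbourhood stays in `K`, which has exactly k|T (c x) ∩ K| points, so primitivity applies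
  -- and |K| = |W|.
  have h1 := h.prim _ hI ⟨x, by simp [T, hx]⟩
    (le_antisymm (h.le_card_closedNbhd hk hI) (hKc ▸ Finset.card_le_card hsub))
  exact Finset.eq_univ_of_card K (hKc.trans h1)

omit h in
theorem of_equiv {W' : Type*} [Fintype W'] {r' : W' → W' → Prop} (h : BalancedPrimitive k r)
    (e : W ≃ W') (he : ∀ a b, r a b ↔ r' (e a) (e b)) : BalancedPrimitive k r' := by
  have hind : ∀ A : Finset W', IndepFor r' A → IndepFor r (A.map e.symm.toEmbedding) := by
    intro A hA a ha b hb hab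
    simp only [Finset.mem_map_equiv, Equiv.symm_symm] at ha hb
    exact hA _ ha _ hb ((he a b).1 hab)
  have hN : ∀ A : Finset W', closedNbhd r (A.map e.symm.toEmbedding) =
      (closedNbhd r' A).map e.symm.toEmbedding := by
    intro A
    ext w
    simp only [mem_closedNbhd, Finset.mem_map_equiv, Equiv.symm_symm, he]
    refine or_congr Iff.rfl ⟨fun ⟨a, ha⟩ => ⟨e a, ha⟩, fun ⟨a, ha, hr⟩ => ⟨e.symm a, ?_, ?_⟩⟩
    · simpa using ha
    · simpa using hr
  have hcard := Fintype.card_congr e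
  refine ⟨?_, ?_, ?_, ?_⟩
  · intro a b hab
    have := h.symm (e.symm a) (e.symm b) ((he _ _).2 (by simpa using hab))
    simpa using (he _ _).1 this
  · intro A hA
    simpa [hcard] using h.bound _ (hind A hA)
  · obtain ⟨c, hc, hb⟩ := h.color
    refine ⟨c ∘ e.symm, fun a b hab => hc _ _ ((he _ _).2 (by simpa using hab)), fun i => ?_⟩
    rw [← hcard, ← hb i, ← Finset.card_map e.toEmbedding]
    congr 2
    ext w
    simp [Finset.mem_map_equiv]
  · intro A hA hne hk
    have := h.prim _ (hind A hA) (by simpa using hne) (by rw [hN]; simpa using hk)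
    simpa [hcard] using this

end BalancedPrimitive

end Basic

/-! ### Maximum independent sets of a direct product -/

/-- The adjacency relation of the direct (tensor) product of two graphs. -/
def prodRel {W H : Type*} (r : W → W → Prop) (s : H → H → Prop) : W × H → W × H → Prop :=
  fun a b => r a.1 b.1 ∧ s a.2 b.2

section Product

variable {W H : Type*} [Fintype W] [Fintype H] {k : ℕ} {r : W → W → Prop} {s : H → H → Prop}

open Classical in
/-- The vertices of the fibre of `S` over `b` that are isolated in that fibre. -/
noncomputable def isolatedFiber (r : W → W → Prop) (S : Finset (W × H)) (b : H) : Finset W :=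
  Finset.univ.filter fun a => (a, b) ∈ S ∧ ∀ a', r a a' → (a', b) ∉ S

open Classical in
/-- The `b` for which `a` is a non-isolated vertex of the fibre of `S` over `b`. -/
noncomputable def nonisolatedSection (r : W → W → Prop) (S : Finset (W × H)) (a : W) : Finset H :=
  Finset.univ.filter fun b => (a, b) ∈ S ∧ ∃ a', r a a' ∧ (a', b) ∈ S

omit [Fintype H] in
theorem mem_isolatedFiber {S : Finset (W × H)} {a : W} {b : H} :
    a ∈ isolatedFiber r S b ↔ (a, b) ∈ S ∧ ∀ a', r a a' → (a', b) ∉ S := by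
  simp [isolatedFiber]

theorem mem_nonisolatedSection {S : Finset (W × H)} {a : W} {b : H} :
    b ∈ nonisolatedSection r S a ↔ (a, b) ∈ S ∧ ∃ a', r a a' ∧ (a', b) ∈ S := by
  simp [nonisolatedSection]

theorem mem_iff_isolated_or_nonisolated {S : Finset (W × H)} {a : W} {b : H} :
    (a, b) ∈ S ↔ a ∈ isolatedFiber r S b ∨ b ∈ nonisolatedSection r S a := by
  rw [mem_isolatedFiber, mem_nonisolatedSection]
  by_cases h : ∃ a', r a a' ∧ (a', b) ∈ S
  · tauto
  · push Not at h
    tauto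

theorem card_eq_sum_isolated_add (r : W → W → Prop) (S : Finset (W × H)) :
    S.card = ∑ b, (isolatedFiber r S b).card + ∑ a, (nonisolatedSection r S a).card := by
  classical
  have h1 : ∑ b, (isolatedFiber r S b).card =
      (S.filter fun p => ∀ a', r p.1 a' → (a', p.2) ∉ S).card := by
    rw [Finset.card_eq_sum_card_fiberwise (f := Prod.snd) (t := Finset.univ)
      (fun _ _ => Finset.mem_univ _)]
    refine Finset.sum_congr rfl fun b _ => ?_
    refine Finset.card_bij (fun a _ => (a, b)) ?_ ?_ ?_
    · intro a ha
      simpa [mem_isolatedFiber] using ha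
    · intro a _ a' _ h
      exact (Prod.mk.inj h).1
    · rintro ⟨a, b'⟩ h
      simp only [Finset.mem_filter] at h
      obtain ⟨h, rfl⟩ := h
      exact ⟨a, mem_isolatedFiber.2 h, rfl⟩
  have h2 : ∑ a, (nonisolatedSection r S a).card =
      (S.filter fun p => ¬ ∀ a', r p.1 a' → (a', p.2) ∉ S).card := by
    rw [Finset.card_eq_sum_card_fiberwise (f := Prod.fst) (t := Finset.univ)
      (fun _ _ => Finset.mem_univ _)]
    refine Finset.sum_congr rfl fun a _ => ?_
    refine Finset.card_bij (fun b _ => (a, b)) ?_ ?_ ?_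
    · intro b hb
      simpa [mem_nonisolatedSection] using hb
    · intro b _ b' _ h
      exact (Prod.mk.inj h).2
    · rintro ⟨a', b⟩ h
      simp only [Finset.mem_filter] at h
      obtain ⟨h, rfl⟩ := h
      push Not at h
      exact ⟨b, mem_nonisolatedSection.2 h, rfl⟩
  rw [h1, h2, Finset.card_filter_add_card_filter_not]

omit [Fintype H] in
theorem indepFor_isolatedFiber (S : Finset (W × H)) (b : H) :
    IndepFor r (isolatedFiber r S b) :=
  fun _ ha _ ha' h => (mem_isolatedFiber.1 ha).2 _ h (mem_isolatedFiber.1 ha').1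

/-- If b and b' were adjacent, the neighbour a' of a in the fibre over b would give an edge from
(a', b) to (a, b') inside `S`. -/
theorem IndepFor.nonisolated {S : Finset (W × H)} (hr : ∀ a b, r a b → r b a)
    (hS : IndepFor (prodRel r s) S) (a : W) : IndepFor s (nonisolatedSection r S a) := by
  intro b hb b' hb' h
  obtain ⟨-, a', ha', hm⟩ := mem_nonisolatedSection.1 hb
  exact hS _ hm _ (mem_nonisolatedSection.1 hb').1 ⟨hr _ _ ha', h⟩

open Classical in
/-- The `b` such that `a` lies in the closed neighbourhood of the isolated part of the fibre
of `S` over `b`. -/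
noncomputable def isolatedNbhdSection (r : W → W → Prop) (S : Finset (W × H)) (a : W) : Finset H :=
  Finset.univ.filter fun b => a ∈ closedNbhd r (isolatedFiber r S b)

theorem mem_isolatedNbhdSection {S : Finset (W × H)} {a : W} {b : H} :
    b ∈ isolatedNbhdSection r S a ↔ a ∈ closedNbhd r (isolatedFiber r S b) := by
  simp [isolatedNbhdSection]

theorem sum_card_closedNbhd_isolatedFiber (r : W → W → Prop) (S : Finset (W × H)) :
    ∑ b, (closedNbhd r (isolatedFiber r S b)).card = ∑ a, (isolatedNbhdSection r S a).card := by
  classical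
  simp only [isolatedNbhdSection, Finset.card_filter]
  rw [Finset.sum_comm]
  simp

/-- A common b would either give an isolated point a neighbour in its own fibre or produce an edge
of the product inside `S`. -/
theorem IndepFor.disjoint_sections {S : Finset (W × H)} (hr : ∀ a b, r a b → r b a)
    (hS : IndepFor (prodRel r s) S) (a : W) :
    Disjoint (isolatedNbhdSection r S a) (closedNbhd s (nonisolatedSection r S a)) := by
  rw [Finset.disjoint_left]
  intro b hD hN
  rw [mem_isolatedNbhdSection, mem_closedNbhd] at hD
  rcases mem_closedNbhd.1 hN with hC | ⟨b', hC, hbb⟩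
  · obtain ⟨hm, a', ha', hm'⟩ := mem_nonisolatedSection.1 hC
    rcases hD with hD | ⟨a'', hD, hr'⟩
    · exact (mem_isolatedFiber.1 hD).2 _ ha' hm'
    · exact (mem_isolatedFiber.1 hD).2 _ hr' hm
  · obtain ⟨hm, a', ha', hm'⟩ := mem_nonisolatedSection.1 hC
    rcases hD with hD | ⟨a'', hD, hr'⟩
    · exact hS _ hm' _ (mem_isolatedFiber.1 hD).1 ⟨hr _ _ ha', hbb⟩
    · exact hS _ hm _ (mem_isolatedFiber.1 hD).1 ⟨hr _ _ hr', hbb⟩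

theorem IndepFor.card_sections_le {S : Finset (W × H)} (hr : ∀ a b, r a b → r b a)
    (hS : IndepFor (prodRel r s) S) (a : W) :
    (isolatedNbhdSection r S a).card + (closedNbhd s (nonisolatedSection r S a)).card
      ≤ Fintype.card H := by
  classical
  rw [← Finset.card_union_of_disjoint (hS.disjoint_sections hr a)]
  exact Finset.card_le_univ _

/-- If a and a' are adjacent, a point of `C a'` outside `C a` would be dominated by `C a`, giving an
edge in `S`. So adjacent vertices have equal fibres, and connectedness makes the fibre constant. -/
theorem fibers_eq_of_forall_eq_closedNbhd (hk : 0 < k) (hW : BalancedPrimitive k r) [Nonempty W]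
    {S : Finset (W × H)} (hS : IndepFor (prodRel r s) S)
    {C : W → Finset H} (hC : ∀ a b, (a, b) ∈ S ↔ b ∈ C a)
    (hN : ∀ a, closedNbhd s (C a) = Finset.univ) : ∃ a₀, S = Finset.univ ×ˢ C a₀ := by
  classical
  have hsub : ∀ a a', r a a' → C a' ⊆ C a := by
    intro a a' haa b hb
    have hb' : b ∈ closedNbhd s (C a) := by simp [hN]
    rcases mem_closedNbhd.1 hb' with h | ⟨b₀, h, hbb⟩
    · exact h
    · exact (hS _ ((hC _ _).2 h) _ ((hC _ _).2 hb) ⟨haa, hbb⟩).elim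
  obtain ⟨a₀⟩ := ‹Nonempty W›
  refine ⟨a₀, ?_⟩
  have hK := hW.eq_univ_of_closed hk (K := Finset.univ.filter fun a => C a = C a₀)
    ⟨a₀, by simp⟩ (by
      intro a ha b hab
      simp only [Finset.mem_filter, Finset.mem_univ, true_and] at ha ⊢
      rw [← ha]
      exact (hsub _ _ hab).antisymm (hsub _ _ (hW.symm _ _ hab)))
  ext ⟨a, b⟩
  have : a ∈ Finset.univ.filter fun a => C a = C a₀ := by simp [hK]
  simp only [Finset.mem_filter, Finset.mem_univ, true_and] at this
  simp [hC, this]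

variable (hk : 0 < k) (hW : BalancedPrimitive k r) (hH : BalancedPrimitive k s)
include hk hW hH

theorem IndepFor.card_prod_le {S : Finset (W × H)} (hS : IndepFor (prodRel r s) S) :
    k * S.card ≤ Fintype.card W * Fintype.card H := by
  calc k * S.card = ∑ b, k * (isolatedFiber r S b).card
        + ∑ a, k * (nonisolatedSection r S a).card := by
        rw [card_eq_sum_isolated_add r S, mul_add, Finset.mul_sum, Finset.mul_sum]
    _ ≤ ∑ b, (closedNbhd r (isolatedFiber r S b)).card
        + ∑ a, (closedNbhd s (nonisolatedSection r S a)).card :=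
        add_le_add
          (Finset.sum_le_sum fun b _ => hW.le_card_closedNbhd hk (indepFor_isolatedFiber S b))
          (Finset.sum_le_sum fun a _ => hH.le_card_closedNbhd hk (hS.nonisolated hW.symm a))
    _ = ∑ a, ((isolatedNbhdSection r S a).card
        + (closedNbhd s (nonisolatedSection r S a)).card) := by
        rw [sum_card_closedNbhd_isolatedFiber, Finset.sum_add_distrib]
    _ ≤ ∑ _a : W, Fintype.card H := Finset.sum_le_sum fun a _ => hS.card_sections_le hW.symm a
    _ = _ := by simp

theorem IndepFor.eq_closedNbhd_of_card_prod_eq {S : Finset (W × H)}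
    (hS : IndepFor (prodRel r s) S) (hc : k * S.card = Fintype.card W * Fintype.card H) :
    (∀ b, k * (isolatedFiber r S b).card = (closedNbhd r (isolatedFiber r S b)).card) ∧
    (∀ a, k * (nonisolatedSection r S a).card =
      (closedNbhd s (nonisolatedSection r S a)).card) ∧
    ∀ a, (isolatedNbhdSection r S a).card + (closedNbhd s (nonisolatedSection r S a)).card
      = Fintype.card H := by
  have h1 := fun b : H => hW.le_card_closedNbhd hk (indepFor_isolatedFiber (r := r) S b)
  have h2 := fun a : W => hH.le_card_closedNbhd hk (hS.nonisolated hW.symm a)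
  have h3 := fun a : W => hS.card_sections_le hW.symm a
  have s1 := Finset.sum_le_sum fun b (_ : b ∈ Finset.univ) => h1 b
  have s2 := Finset.sum_le_sum fun a (_ : a ∈ Finset.univ) => h2 a
  have s3 := Finset.sum_le_sum fun a (_ : a ∈ Finset.univ) => h3 a
  have e : k * S.card = ∑ b, k * (isolatedFiber r S b).card
        + ∑ a, k * (nonisolatedSection r S a).card := by
    rw [card_eq_sum_isolated_add r S, mul_add, Finset.mul_sum, Finset.mul_sum]
  have e2 : ∑ _a : W, Fintype.card H = Fintype.card W * Fintype.card H := by simp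
  have e3 : ∑ a, ((isolatedNbhdSection r S a).card
        + (closedNbhd s (nonisolatedSection r S a)).card) = _ := Finset.sum_add_distrib
  rw [← sum_card_closedNbhd_isolatedFiber] at e3
  -- The three families of inequalities chain to the bound of `IndepFor.card_prod_le`; equality of
  -- the ends makes every term an equality.
  refine ⟨fun b => ?_, fun a => ?_, fun a => ?_⟩
  · exact (Finset.sum_eq_sum_iff_of_le fun b _ => h1 b).1 (by omega) b (Finset.mem_univ _)
  · exact (Finset.sum_eq_sum_iff_of_le fun a _ => h2 a).1 (by omega) a (Finset.mem_univ _)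
  · exact (Finset.sum_eq_sum_iff_of_le fun a _ => h3 a).1 (by omega) a (Finset.mem_univ _)

/-- Maximum independent sets of a direct product are pulled back from one of the factors. -/
theorem IndepFor.eq_prod_of_card_eq [Nonempty W] [Nonempty H] {S : Finset (W × H)}
    (hS : IndepFor (prodRel r s) S) (hc : k * S.card = Fintype.card W * Fintype.card H) :
    (∃ A, IndepFor r A ∧ k * A.card = Fintype.card W ∧ S = A ×ˢ Finset.univ) ∨
    (∃ C, IndepFor s C ∧ k * C.card = Fintype.card H ∧ S = Finset.univ ×ˢ C) := by
  classical
  obtain ⟨h1, h2, h3⟩ := hS.eq_closedNbhd_of_card_prod_eq hk hW hH hc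
  by_cases hA : ∀ b, isolatedFiber r S b = ∅
  · right
    have hmem : ∀ a b, (a, b) ∈ S ↔ b ∈ nonisolatedSection r S a := by
      intro a b
      rw [mem_iff_isolated_or_nonisolated (r := r), hA]
      simp
    have hD : ∀ a, isolatedNbhdSection r S a = ∅ := by
      intro a
      ext b
      simp [mem_isolatedNbhdSection, hA, mem_closedNbhd]
    have hN : ∀ a, closedNbhd s (nonisolatedSection r S a) = Finset.univ := by
      intro a
      have := h3 a
      rw [hD, Finset.card_empty, zero_add] at this
      exact Finset.eq_univ_of_card _ this
    obtain ⟨a₀, ha₀⟩ := fibers_eq_of_forall_eq_closedNbhd hk hW hS hmem hN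
    refine ⟨_, hS.nonisolated hW.symm a₀, ?_, ha₀⟩
    rw [h2, hN, Finset.card_univ]
  · left
    push Not at hA
    obtain ⟨b₀, hb₀⟩ := hA
    -- One nonempty isolated part is already maximum and dominates all of `W`. Then `b₀` lies in
    -- every `isolatedNbhdSection`, and disjointness leaves no room for non-isolated points.
    have hb1 := hW.prim _ (indepFor_isolatedFiber S b₀) hb₀ (h1 b₀)
    have hb2 : closedNbhd r (isolatedFiber r S b₀) = Finset.univ :=
      Finset.eq_univ_of_card _ ((h1 b₀).symm.trans hb1)
    have hC : ∀ a, nonisolatedSection r S a = ∅ := by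
      intro a
      by_contra hne
      have h4 := hH.prim _ (hS.nonisolated hW.symm a) (Finset.nonempty_iff_ne_empty.2 hne)
        (h2 a)
      have h5 : closedNbhd s (nonisolatedSection r S a) = Finset.univ :=
        Finset.eq_univ_of_card _ ((h2 a).symm.trans h4)
      have h6 : b₀ ∈ isolatedNbhdSection r S a := by simp [mem_isolatedNbhdSection, hb2]
      exact Finset.disjoint_left.1 (hS.disjoint_sections hW.symm a) h6 (by simp [h5])
    have hD : ∀ a, isolatedNbhdSection r S a = Finset.univ := by
      intro a
      have := h3 a
      rw [hC] at this
      refine Finset.eq_univ_of_card _ ?_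
      have h0 : closedNbhd s (∅ : Finset H) = ∅ := by
        ext
        simp [mem_closedNbhd]
      rw [h0] at this
      simpa using this
    have hN : ∀ b, closedNbhd r (isolatedFiber r S b) = Finset.univ := by
      intro b
      ext a
      rw [← mem_isolatedNbhdSection, hD]
      simp
    -- With the factors swapped, the isolated parts play the role of the fibres.
    have hS' : IndepFor (prodRel s r) (S.map (Equiv.prodComm W H).toEmbedding) := by
      rintro ⟨b, a⟩ ha ⟨b', a'⟩ hb ⟨hs', hr'⟩
      rw [Finset.mem_map_equiv] at ha hb
      exact hS _ ha _ hb ⟨hr', hs'⟩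
    obtain ⟨b₁, hb₁⟩ := fibers_eq_of_forall_eq_closedNbhd hk hH hS'
      (C := isolatedFiber r S) (by
        intro b a
        rw [Finset.mem_map_equiv]
        change (a, b) ∈ S ↔ _
        rw [mem_iff_isolated_or_nonisolated (r := r), hC]
        simp) hN
    refine ⟨_, indepFor_isolatedFiber S b₁, ?_, ?_⟩
    · rw [h1, hN, Finset.card_univ]
    · ext ⟨a, b⟩
      have : (b, a) ∈ S.map (Equiv.prodComm W H).toEmbedding ↔ (a, b) ∈ S := by
        rw [Finset.mem_map_equiv]
        rfl
      rw [← this, hb₁]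
      simp

end Product

/-! ### Primitivity of a direct product -/

section Product

variable {W H : Type*} [Fintype W] [Fintype H] {k : ℕ} {r : W → W → Prop} {s : H → H → Prop}

theorem card_filter_fst_eq [DecidableEq W] (c : W → Fin k) (i : Fin k) :
    (Finset.univ.filter fun p : W × H => c p.1 = i) =
      (Finset.univ.filter fun w => c w = i) ×ˢ Finset.univ := by
  ext ⟨a, b⟩
  simp

theorem closedNbhd_prod_univ (hs : ∀ y, ∃ z, s y z) (hs' : ∀ a b, s a b → s b a) (A : Finset W) :
    closedNbhd (prodRel r s) (A ×ˢ (Finset.univ : Finset H)) =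
      closedNbhd r A ×ˢ Finset.univ := by
  ext ⟨x, y⟩
  simp only [mem_closedNbhd, Finset.mem_product, Finset.mem_univ, and_true, Prod.exists, prodRel]
  refine or_congr Iff.rfl ⟨?_, ?_⟩
  · rintro ⟨a, b, ha, h, -⟩
    exact ⟨a, ha, h⟩
  · rintro ⟨a, ha, h⟩
    obtain ⟨z, hz⟩ := hs y
    exact ⟨a, z, ha, h, hs' _ _ hz⟩

namespace BalancedPrimitive

variable [Nonempty W] [Nonempty H] (hk : 3 ≤ k) (hW : BalancedPrimitive k r)
  (hH : BalancedPrimitive k s)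
include hk hW hH

/-- Enlarging a non-maximum `S` by a colour class pulled back from `W` gives maximum sets `M i`,
which come from one factor and agree with `S` off colour i. Comparing different colours shows that
`S` itself comes from `W`, where primitivity is known. -/
theorem prod_prim {S : Finset (W × H)} (hS : IndepFor (prodRel r s) S) (hne : S.Nonempty)
    (hc : k * S.card = (closedNbhd (prodRel r s) S).card) :
    k * S.card = Fintype.card (W × H) := by
  classical
  have hk0 : 0 < k := by omega
  rw [Fintype.card_prod]
  by_contra hlt
  obtain ⟨c, hcol, hbal⟩ := hW.color
  have hsymm : ∀ a b, prodRel r s a b → prodRel r s b a :=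
    fun a b h => ⟨hW.symm _ _ h.1, hH.symm _ _ h.2⟩
  have hcolP : ∀ a b : W × H, prodRel r s a b → c a.1 ≠ c b.1 := fun a b h => hcol _ _ h.1
  have hbalP : ∀ i, k * (Finset.univ.filter fun p : W × H => c p.1 = i).card =
      Fintype.card W * Fintype.card H := by
    intro i
    rw [card_filter_fst_eq, Finset.card_product, ← mul_assoc, hbal, Finset.card_univ]
  have hWpos : 0 < Fintype.card W := Fintype.card_pos
  have hHpos : 0 < Fintype.card H := Fintype.card_pos
  -- the set obtained from `S` by adding the part of a colour class outside `N[S]`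
  obtain ⟨M, hMdef⟩ : ∃ M : Fin k → Finset (W × H), ∀ i, M i = S ∪
      ((Finset.univ.filter fun p : W × H => c p.1 = i) \ closedNbhd (prodRel r s) S) :=
    ⟨_, fun _ => rfl⟩
  have hMind : ∀ i, IndepFor (prodRel r s) (M i) := by
    intro i
    rw [hMdef]
    exact hS.exchange hsymm (indepFor_color (c := fun p : W × H => c p.1) hcolP i)
  have hle : ∀ i, S.card ≤ ((Finset.univ.filter fun p : W × H => c p.1 = i) ∩
      closedNbhd (prodRel r s) S).card := by
    intro i
    have h1 := (hMind i).card_prod_le hk0 hW hH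
    rw [← hbalP i] at h1
    have h2 := Nat.le_of_mul_le_mul_left h1 hk0
    have h3 := card_exchange (r := prodRel r s) S (Finset.univ.filter fun p : W × H => c p.1 = i)
    rw [← hMdef] at h3
    omega
  -- The bounds `hle` sum to k|S| ≤ |N[S]|, which is an equality, so each is tight and the exchange
  -- loses nothing.
  have hMcard : ∀ i, k * (M i).card = Fintype.card W * Fintype.card H := by
    intro i
    have hsum : ∑ _i : Fin k, S.card =
        ∑ i, ((Finset.univ.filter fun p : W × H => c p.1 = i) ∩
          closedNbhd (prodRel r s) S).card := by
      rw [← card_eq_sum_color (fun p : W × H => c p.1), ← hc]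
      simp
    have h1 := (Finset.sum_eq_sum_iff_of_le fun i _ => hle i).1 hsum i (Finset.mem_univ i)
    have h3 := card_exchange (r := prodRel r s) S (Finset.univ.filter fun p : W × H => c p.1 = i)
    rw [← hMdef] at h3
    rw [← hbalP i]
    congr 1
    omega
  have hMS : ∀ i x y, c x ≠ i → ((x, y) ∈ M i ↔ (x, y) ∈ S) := by
    intro i x y hx
    simp [hMdef, hx]
  have hSM : ∀ i, S ⊆ M i := by
    intro i
    rw [hMdef]
    exact Finset.subset_union_left
  have hcls := fun i => (hMind i).eq_prod_of_card_eq hk0 hW hH (hMcard i)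
  have hcolne : ∀ i, ∃ x, c x = i := by
    intro i
    have h1 := hbal i
    by_contra! hno
    have h2 : (Finset.univ.filter fun w => c w = i) = ∅ := by
      ext x
      simp [hno]
    rw [h2] at h1
    simp at h1
    omega
  have hex1 : ∀ i : Fin k, ∃ j, j ≠ i := by
    intro i
    have : Nontrivial (Fin k) := Fin.nontrivial_iff_two_le.2 (by omega)
    exact exists_ne i
  have hex2 : ∀ i j : Fin k, ∃ l, l ≠ i ∧ l ≠ j := by
    intro i j
    have h1 : ({i, j} : Finset (Fin k)).card < (Finset.univ : Finset (Fin k)).card := by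
      have := Finset.card_le_two (a := i) (b := j)
      simp
      omega
    obtain ⟨l, -, hl⟩ := Finset.exists_mem_notMem_of_card_lt_card h1
    simp only [Finset.mem_insert, Finset.mem_singleton, not_or] at hl
    exact ⟨l, hl⟩
  have hA : ∀ i, ∃ A : Finset W, M i = A ×ˢ Finset.univ := by
    intro i
    rcases hcls i with ⟨A, -, -, hA⟩ | ⟨C, -, hCc, hC⟩
    · exact ⟨A, hA⟩
    exfalso
    have hCS : ∀ x y, c x ≠ i → ((x, y) ∈ S ↔ y ∈ C) := by
      intro x y hx
      rw [← hMS i x y hx, hC]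
      simp
    obtain ⟨y₀, hy₀⟩ : C.Nonempty := by
      rw [Finset.nonempty_iff_ne_empty]
      rintro rfl
      simp at hCc
      omega
    -- Here k ≥ 3 is essential: off colour i the set `S` looks like W × C, and a third colour l is
    -- visible in both `M i` and `M j`.
    obtain ⟨j, hj⟩ := hex1 i
    obtain ⟨l, hli, hlj⟩ := hex2 i j
    rcases hcls j with ⟨A, -, hAc, hA⟩ | ⟨C', -, -, hC'⟩
    -- `A` would contain two whole colour classes while having the size of one.
    · have hsub : (Finset.univ.filter fun w => c w = j) ∪ (Finset.univ.filter fun w => c w = l)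
          ⊆ A := by
        intro x hx
        simp only [Finset.mem_union, Finset.mem_filter, Finset.mem_univ, true_and] at hx
        have hxi : c x ≠ i := by
          rcases hx with hx | hx <;> rw [hx] <;> assumption
        have := hSM j ((hCS x y₀ hxi).2 hy₀)
        rw [hA] at this
        exact (Finset.mem_product.1 this).1
      have h1 := Finset.card_le_card hsub
      rw [Finset.card_union_of_disjoint] at h1
      · have h2 := Nat.mul_le_mul_left k h1
        rw [mul_add, hbal, hbal, hAc] at h2
        omega
      · rw [Finset.disjoint_left]
        intro x hx hx'
        simp only [Finset.mem_filter, Finset.mem_univ, true_and] at hx hx'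
        exact hlj (hx'.symm.trans hx)
    -- Colour l forces C' = C, and `M j` shows that `S` has fibre C over colour i too; so `M i ⊆ S`
    -- and `S` is maximum.
    · obtain ⟨x₁, hx₁⟩ := hcolne l
      have hCC : ∀ y, y ∈ C' ↔ y ∈ C := by
        intro y
        rw [← hCS x₁ y (hx₁ ▸ hli), ← hMS j x₁ y (hx₁ ▸ hlj), hC']
        simp
      have hsub : M i ⊆ S := by
        rintro ⟨x, y⟩ hxy
        by_cases hx : c x = i
        · rw [hC] at hxy
          have hy := (Finset.mem_product.1 hxy).2
          rw [← hMS j x y (hx ▸ hj.symm), hC']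
          simpa using (hCC y).2 hy
        · exact (hMS i x y hx).1 hxy
      have h1 := Finset.card_le_card hsub
      have h2 := hS.card_prod_le hk0 hW hH
      have h3 := Nat.mul_le_mul_left k h1
      rw [hMcard] at h3
      exact hlt (le_antisymm h2 h3)
  have hmem : ∀ x y y', (x, y) ∈ S → (x, y') ∈ S := by
    intro x y y' hxy
    obtain ⟨i, hi⟩ := hex1 (c x)
    obtain ⟨A, hA⟩ := hA i
    rw [← hMS i x y hi.symm, hA] at hxy
    rw [← hMS i x y' hi.symm, hA]
    simpa using hxy
  obtain ⟨A, hSA⟩ : ∃ A : Finset W, S = A ×ˢ Finset.univ := by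
    refine ⟨S.image Prod.fst, ?_⟩
    ext ⟨x, y⟩
    simp only [Finset.mem_product, Finset.mem_image, Prod.exists, exists_and_right,
      exists_eq_right, Finset.mem_univ, and_true]
    exact ⟨fun h => ⟨y, h⟩, fun ⟨y', h⟩ => hmem _ _ _ h⟩
  have hnb := hH.exists_neighbor (by omega)
  rw [hSA, closedNbhd_prod_univ hnb hH.symm, Finset.card_product, Finset.card_product,
    ← mul_assoc, Finset.card_univ] at hc
  have hAi : IndepFor r A := by
    intro a ha b hb hab
    obtain ⟨y⟩ := ‹Nonempty H›
    obtain ⟨z, hz⟩ := hnb y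
    exact hS (a, y) (by simp [hSA, ha]) (b, z) (by simp [hSA, hb]) ⟨hab, hz⟩
  have hAne : A.Nonempty := by
    obtain ⟨p, hp⟩ := hne
    rw [hSA] at hp
    exact ⟨_, (Finset.mem_product.1 hp).1⟩
  have hAp := hW.prim A hAi hAne (Nat.eq_of_mul_eq_mul_right hHpos hc)
  apply hlt
  rw [hSA, Finset.card_product, ← mul_assoc, hAp, Finset.card_univ]

theorem prod : BalancedPrimitive k (prodRel r s) where
  symm _ _ h := ⟨hW.symm _ _ h.1, hH.symm _ _ h.2⟩
  bound S hS := by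
    rw [Fintype.card_prod]
    exact hS.card_prod_le (by omega) hW hH
  color := by
    classical
    obtain ⟨c, hcol, hbal⟩ := hW.color
    refine ⟨fun p => c p.1, fun a b h => hcol _ _ h.1, fun i => ?_⟩
    rw [card_filter_fst_eq, Finset.card_product, ← mul_assoc, hbal, Finset.card_univ,
      Fintype.card_prod]
  prim _ hS hne hc := prod_prim hk hW hH hS hne hc

end BalancedPrimitive

end Product

/-! ### Direct powers -/

section Power

/-- The adjacency relation of the `n`-th direct power of a graph. -/
def powRel {W : Type*} (r : W → W → Prop) (n : ℕ) : (Fin n → W) → (Fin n → W) → Prop :=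
  fun f g => ∀ i, r (f i) (g i)

variable {W : Type*} [Fintype W] [Nonempty W] {k : ℕ} {r : W → W → Prop}

omit [Fintype W] [Nonempty W] in
theorem powRel_cons {n : ℕ} (a b : W × (Fin n → W)) :
    prodRel r (powRel r n) a b ↔
      powRel r (n + 1) (Fin.consEquiv (fun _ => W) a) (Fin.consEquiv (fun _ => W) b) := by
  simp [powRel, prodRel, Fin.forall_fin_succ, Fin.consEquiv]

theorem BalancedPrimitive.pow (hk : 3 ≤ k) (hW : BalancedPrimitive k r) (n : ℕ) :
    BalancedPrimitive k (powRel r (n + 1)) := by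
  induction n with
  | zero =>
    exact hW.of_equiv (Equiv.funUnique (Fin 1) W).symm fun a b => by simp [powRel]
  | succ n ih => exact (prod hk hW ih).of_equiv (Fin.consEquiv fun _ => W) powRel_cons

/-- Maximum independent sets of a direct power are pulled back from a coordinate. -/
theorem IndepFor.eq_preimage_of_card_pow_eq (hk : 3 ≤ k) (hW : BalancedPrimitive k r) (n : ℕ)
    {S : Finset (Fin (n + 1) → W)} (hS : IndepFor (powRel r (n + 1)) S)
    (hc : k * S.card = Fintype.card (Fin (n + 1) → W)) :
    ∃ i, ∃ A : Finset W, IndepFor r A ∧ k * A.card = Fintype.card W ∧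
      ∀ f, f ∈ S ↔ f i ∈ A := by
  induction n with
  | zero =>
    refine ⟨0, S.map (Equiv.funUnique (Fin 1) W).toEmbedding, ?_, ?_, ?_⟩
    · intro a ha b hb hab
      rw [Finset.mem_map_equiv] at ha hb
      exact hS _ ha _ hb fun i => by simpa using hab
    · rw [Finset.card_map, hc]
      simp
    · intro f
      rw [Finset.mem_map_equiv]
      have : (Equiv.funUnique (Fin 1) W).symm (f 0) = f := by
        ext i
        simp [Subsingleton.elim i 0]
      rw [this]
  | succ n ih =>
    have hS' : IndepFor (prodRel r (powRel r (n + 1)))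
        (S.map (Fin.consEquiv fun _ => W).symm.toEmbedding) := by
      intro a ha b hb hab
      rw [Finset.mem_map_equiv] at ha hb
      exact hS _ ha _ hb ((powRel_cons a b).1 hab)
    have hc' : k * (S.map (Fin.consEquiv fun _ => W).symm.toEmbedding).card =
        Fintype.card W * Fintype.card (Fin (n + 1) → W) := by
      rw [Finset.card_map, hc, ← Fintype.card_prod]
      exact Fintype.card_congr (Fin.consEquiv fun _ => W).symm
    have hmem : ∀ f, f ∈ S ↔
        (f 0, Fin.tail f) ∈ S.map (Fin.consEquiv fun _ => W).symm.toEmbedding := by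
      intro f
      rw [Finset.mem_map_equiv]
      simp [Fin.consEquiv]
    rcases hS'.eq_prod_of_card_eq (by omega) hW (hW.pow hk n) hc' with
      ⟨A, hA, hAc, h⟩ | ⟨C, hC, hCc, h⟩
    · refine ⟨0, A, hA, hAc, fun f => ?_⟩
      rw [hmem, h]
      simp
    · obtain ⟨i, A, hA, hAc, h'⟩ := ih hC hCc
      refine ⟨i.succ, A, hA, hAc, fun f => ?_⟩
      rw [hmem, h]
      simp [h', Fin.tail]

end Power

/-! ### IS-primitivity without fractions -/

section Graph

variable {W : Type*}

theorem indepFor_adj_iff (Γ : SimpleGraph W) (A : Finset W) :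
    IndepFor Γ.Adj A ↔ Γ.IsIndepSet (A : Set W) := by
  constructor
  · intro h a ha b hb _
    exact h a ha b hb
  · intro h a ha b hb hab
    exact h ha hb hab.ne hab

variable [Fintype W]

theorem mul_indepNum_eq {k : ℕ} (Γ : SimpleGraph W)
    (hb : ∀ A : Finset W, IndepFor Γ.Adj A → k * A.card ≤ Fintype.card W)
    {T : Finset W} (hT : IndepFor Γ.Adj T) (hTc : k * T.card = Fintype.card W) :
    k * Γ.indepNum = Fintype.card W := by
  classical
  obtain ⟨M, hM⟩ := Γ.exists_isNIndepSet_indepNum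
  refine le_antisymm ?_ ?_
  · rw [← hM.card_eq]
    exact hb M ((indepFor_adj_iff Γ M).2 hM.isIndepSet)
  · rw [← hTc]
    exact Nat.mul_le_mul_left k (((indepFor_adj_iff Γ T).1 hT).card_le_indepNum)

/-- Since α = |W|/k, the ratio condition reads |A|/|N[A]| = 1/k. -/
theorem isPrimitive_iff [Nonempty W] {k : ℕ} (Γ : SimpleGraph W)
    (hα : k * Γ.indepNum = Fintype.card W) :
    ISPrimitive Γ ↔ ∀ A : Finset W, IndepFor Γ.Adj A → A.Nonempty →
      k * A.card = (closedNbhd Γ.Adj A).card → k * A.card = Fintype.card W := by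
  classical
  have hWpos : 0 < Fintype.card W := Fintype.card_pos
  have hα0 : Γ.indepNum ≠ 0 := by
    intro h
    simp [h] at hα
    omega
  have hk0 : k ≠ 0 := by
    rintro rfl
    simp at hα
    omega
  have hcl : ∀ A : Finset W, closedNeighborhood Γ (A : Set W) = closedNbhd Γ.Adj A := by
    intro A
    ext w
    simp [closedNeighborhood, mem_closedNbhd]
  have hratio : ∀ A : Finset W, A.Nonempty →
      (((A : Set W).ncard : ℚ) / ((closedNeighborhood Γ (A : Set W)).ncard : ℚ) =
        (Γ.indepNum : ℚ) / (Nat.card W : ℚ) ↔ k * A.card = (closedNbhd Γ.Adj A).card) := by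
    intro A hA
    have hN : 0 < (closedNbhd Γ.Adj A).card :=
      Finset.card_pos.2 (hA.mono (subset_closedNbhd A))
    rw [hcl, Set.ncard_coe_finset, Set.ncard_coe_finset, Nat.card_eq_fintype_card, ← hα]
    have hNq : ((closedNbhd Γ.Adj A).card : ℚ) ≠ 0 := by positivity
    have hkq : (k : ℚ) ≠ 0 := by exact_mod_cast hk0
    have hαq : (Γ.indepNum : ℚ) ≠ 0 := by exact_mod_cast hα0
    have hone : (Γ.indepNum : ℚ) / ((k * Γ.indepNum : ℕ) : ℚ) = 1 / k := by
      push_cast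
      field_simp
    rw [hone, div_eq_div_iff hNq hkq, one_mul, mul_comm]
    norm_cast
  have hlt : ∀ A : Finset W, IndepFor Γ.Adj A →
      (A.card < Γ.indepNum ↔ k * A.card ≠ Fintype.card W) := by
    intro A hA
    have h1 := ((indepFor_adj_iff Γ A).1 hA).card_le_indepNum
    rw [← hα, Ne, Nat.mul_right_inj hk0]
    omega
  constructor
  · intro h A hA hne hN
    by_contra hc
    exact h ⟨A, by simpa using hne, (indepFor_adj_iff Γ A).1 hA,
      by rw [Set.ncard_coe_finset]; exact (hlt A hA).2 hc, (hratio A hne).2 hN⟩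
  · rintro h ⟨B, hne, hB, hBc, hr⟩
    obtain ⟨A, rfl⟩ : ∃ A : Finset W, (A : Set W) = B := ⟨B.toFinset, by simp⟩
    have hA := (indepFor_adj_iff Γ A).2 hB
    have hne' : A.Nonempty := by simpa using hne
    rw [Set.ncard_coe_finset] at hBc
    exact (hlt A hA).1 hBc (h A hA hne' ((hratio A hne').1 hr))

end Graph

/-! ### Derangement graphs and strict EKR; the "if" direction -/

section Perm

/-- Two indices are related when the permutations they label agree nowhere. -/
def disagreeRel {U W : Type*} (e : W → Equiv.Perm U) : W → W → Prop :=
  fun a b => ∀ u, e a u ≠ e b u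

theorem mem_smul_stabilizer {U : Type*} {X : Subgroup (Equiv.Perm U)} (g h : X) (u : U) :
    h ∈ g • (MulAction.stabilizer X u : Set X) ↔
      (h : Equiv.Perm U) u = (g : Equiv.Perm U) u := by
  rw [Set.mem_smul_set_iff_inv_smul_mem, SetLike.mem_coe, MulAction.mem_stabilizer_iff,
    smul_eq_mul, mul_smul, inv_smul_eq_iff]
  rfl

/-- The labelling `e` lets G be treated as itself and the internal power as tuples, with cosets
turned into conditions on the image of one point. -/
theorem strictEKR_iff {U W : Type*} [Fintype W] (X : Subgroup (Equiv.Perm U)) (e : W ≃ X) :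
    StrictEKR X ↔ ∀ S : Finset W, IndepFor (disagreeRel fun a => (e a : Equiv.Perm U)) S →
      (∀ T : Finset W, IndepFor (disagreeRel fun a => (e a : Equiv.Perm U)) T →
        T.card ≤ S.card) →
      ∃ a u, ∀ b, b ∈ S ↔ (e b : Equiv.Perm U) u = (e a : Equiv.Perm U) u := by
  classical
  have hI : ∀ S : Finset W, IsIntersecting (e '' (S : Set W)) ↔
      IndepFor (disagreeRel fun a => (e a : Equiv.Perm U)) S := by
    intro S
    simp only [IsIntersecting, Set.forall_mem_image, IndepFor, disagreeRel, Finset.mem_coe]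
    push Not
    rfl
  have hcard : ∀ S : Finset W, (e '' (S : Set W)).ncard = S.card := by
    intro S
    rw [Set.ncard_image_of_injective _ e.injective, Set.ncard_coe_finset]
  have hsurj : ∀ I : Set X, ∃ S : Finset W, e '' (S : Set W) = I := by
    intro I
    refine ⟨(e ⁻¹' I).toFinset, ?_⟩
    simp [Set.image_preimage_eq _ e.surjective]
  have hmax : ∀ S : Finset W, IsMaximumIntersecting (e '' (S : Set W)) ↔
      IndepFor (disagreeRel fun a => (e a : Equiv.Perm U)) S ∧
      ∀ T : Finset W, IndepFor (disagreeRel fun a => (e a : Equiv.Perm U)) T →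
        T.card ≤ S.card := by
    intro S
    refine and_congr (hI S) ⟨fun h T hT => ?_, fun h J hJ => ?_⟩
    · have := h _ ((hI T).2 hT)
      rwa [hcard, hcard] at this
    · obtain ⟨T, rfl⟩ := hsurj J
      rw [hcard, hcard]
      exact h T ((hI T).1 hJ)
  have hcoset : ∀ (S : Finset W) (a : W) (u : U),
      e '' (S : Set W) = e a • (MulAction.stabilizer X u : Set X) ↔
        ∀ b, b ∈ S ↔ (e b : Equiv.Perm U) u = (e a : Equiv.Perm U) u := by
    intro S a u
    rw [Set.ext_iff, e.surjective.forall]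
    refine forall_congr' fun b => ?_
    rw [mem_smul_stabilizer, e.injective.mem_set_image, Finset.mem_coe]
  constructor
  · intro h S hS hm
    obtain ⟨g, u, hg⟩ := h _ ((hmax S).2 ⟨hS, hm⟩)
    obtain ⟨a, rfl⟩ := e.surjective g
    exact ⟨a, u, (hcoset S a u).1 hg⟩
  · intro h I hm
    obtain ⟨S, rfl⟩ := hsurj I
    obtain ⟨hS, hm'⟩ := (hmax S).1 hm
    obtain ⟨a, u, hb⟩ := h S hS hm'
    exact ⟨e a, u, (hcoset S a u).2 hb⟩

variable {V : Type*} (G : Subgroup (Equiv.Perm V))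

theorem derangementGraph_adj_iff [Nonempty V] (g h : G) :
    (derangementGraph G).Adj g h ↔ disagreeRel (fun a : G => (a : Equiv.Perm V)) g h := by
  have key : ((g * h⁻¹ : G) : Equiv.Perm V) ∈ derangements V ↔
      ∀ v, (g : Equiv.Perm V) v ≠ (h : Equiv.Perm V) v := by
    simp only [derangements, Set.mem_ofPred_eq]
    rw [(h : Equiv.Perm V).surjective.forall]
    simp
  change g ≠ h ∧ _ ↔ _
  rw [key]
  refine and_iff_right_of_imp fun hd hgh => ?_
  obtain ⟨v⟩ := ‹Nonempty V›
  exact hd v (by rw [hgh])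

theorem derangementGraph_adj_eq [Nonempty V] :
    (derangementGraph G).Adj = disagreeRel fun a : G => (a : Equiv.Perm V) := by
  ext g h
  exact derangementGraph_adj_iff G g h

/-- Left translations permute the fibres of g ↦ g v transitively, so all |V| fibres have the same
size. -/
theorem card_mul_card_map_eq [Fintype V] [DecidableEq V] [Fintype G]
    (hG : MulAction.IsPretransitive G V) (v w : V) :
    Fintype.card V * (Finset.univ.filter fun g : G => (g : Equiv.Perm V) v = w).card =
      Fintype.card G := by
  have h1 : ∀ w', (Finset.univ.filter fun g : G => (g : Equiv.Perm V) v = w').card =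
      (Finset.univ.filter fun g : G => (g : Equiv.Perm V) v = w).card := by
    intro w'
    obtain ⟨g₀, hg₀⟩ := hG.exists_smul_eq w' w
    change (g₀ : Equiv.Perm V) w' = w at hg₀
    refine Finset.card_equiv (Equiv.mulLeft g₀) fun g => ?_
    simp [← hg₀]
  have h2 := Finset.card_eq_sum_card_fiberwise (s := (Finset.univ : Finset G))
    (f := fun g : G => (g : Equiv.Perm V) v) (t := Finset.univ) (fun _ _ => Finset.mem_univ _)
  rw [Finset.sum_congr rfl fun w' _ => h1 w'] at h2
  simpa using h2.symm

theorem internalDirectProduct_apply_mem {n : ℕ} (f : Fin n → G) :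
    Equiv.Perm.sigmaCongrRightHom (fun _ : Fin n => V) (fun i => (f i : Equiv.Perm V)) ∈
      internalDirectProduct (fun _ : Fin n => G) :=
  ⟨_, fun i _ => (f i).2, rfl⟩

/-- The internal direct power of `G` is parametrized by tuples of elements of `G`. -/
noncomputable def tupleEquiv (n : ℕ) :
    (Fin n → G) ≃ internalDirectProduct (fun _ : Fin n => G) :=
  Equiv.ofBijective (fun f => ⟨_, internalDirectProduct_apply_mem G f⟩) (by
    constructor
    · intro f g h
      have h' := Equiv.Perm.sigmaCongrRightHom_injective (congrArg Subtype.val h)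
      funext i
      exact Subtype.ext (congrFun h' i)
    · rintro ⟨_, f, hf, rfl⟩
      exact ⟨fun i => ⟨f i, hf i trivial⟩, rfl⟩)

theorem tupleEquiv_apply {n : ℕ} (f : Fin n → G) (i : Fin n) (v : V) :
    (tupleEquiv G n f : Equiv.Perm (Σ _ : Fin n, V)) ⟨i, v⟩ =
      ⟨i, (f i : Equiv.Perm V) v⟩ := rfl

theorem disagreeRel_tupleEquiv (n : ℕ) :
    (disagreeRel fun f : Fin n → G => (tupleEquiv G n f : Equiv.Perm (Σ _ : Fin n, V))) =
      powRel (disagreeRel fun a : G => (a : Equiv.Perm V)) n := by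
  ext f g
  simp [disagreeRel, powRel, tupleEquiv_apply, Sigma.forall]

theorem strictEKR_internalDirectProduct_iff [Fintype G] (n : ℕ) :
    StrictEKR (internalDirectProduct fun _ : Fin n => G) ↔
      ∀ S : Finset (Fin n → G),
        IndepFor (powRel (disagreeRel fun a : G => (a : Equiv.Perm V)) n) S →
        (∀ T : Finset (Fin n → G),
          IndepFor (powRel (disagreeRel fun a : G => (a : Equiv.Perm V)) n) T →
          T.card ≤ S.card) →
        ∃ (f : Fin n → G) (i : Fin n) (v : V), ∀ g, g ∈ S ↔
          (g i : Equiv.Perm V) v = (f i : Equiv.Perm V) v := by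
  rw [strictEKR_iff _ (tupleEquiv G n), disagreeRel_tupleEquiv]
  simp [Sigma.exists, tupleEquiv_apply]

theorem exists_maximum_indepFor {W : Type*} [Fintype W] (r : W → W → Prop) :
    ∃ S, IndepFor r S ∧ ∀ T, IndepFor r T → T.card ≤ S.card := by
  classical
  obtain ⟨S, hS, hm⟩ := Finset.exists_max_image
    ((Finset.univ : Finset (Finset W)).filter (IndepFor r)) Finset.card
    ⟨∅, by simp [IndepFor]⟩
  simp only [Finset.mem_filter, Finset.mem_univ, true_and] at hS hm
  exact ⟨S, hS, hm⟩

variable {G}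

theorem disagreeRel_symm {U W : Type*} {e : W → Equiv.Perm U} (a b : W)
    (h : disagreeRel e a b) : disagreeRel e b a :=
  fun u => (h u).symm

theorem indepFor_map_eq [DecidableEq V] [Fintype G] (v w : V) :
    IndepFor (disagreeRel fun a : G => (a : Equiv.Perm V))
      (Finset.univ.filter fun g : G => (g : Equiv.Perm V) v = w) := by
  intro a ha b hb hab
  simp only [Finset.mem_filter, Finset.mem_univ, true_and] at ha hb
  exact hab v (ha.trans hb.symm)

theorem mul_indepNum_derangementGraph [Fintype V] [Nonempty V] [Fintype G]
    (hG : MulAction.IsPretransitive G V)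
    (hb : ∀ A : Finset G, IndepFor (disagreeRel fun a : G => (a : Equiv.Perm V)) A →
      Fintype.card V * A.card ≤ Fintype.card G) :
    Fintype.card V * (derangementGraph G).indepNum = Fintype.card G := by
  classical
  obtain ⟨v⟩ := ‹Nonempty V›
  refine mul_indepNum_eq _ ?_ (T := Finset.univ.filter fun g : G => (g : Equiv.Perm V) v = v) ?_
    (card_mul_card_map_eq G hG v v)
  · rwa [derangementGraph_adj_eq]
  · rw [derangementGraph_adj_eq]
    exact indepFor_map_eq v v

theorem ISPrimitive.balancedPrimitive [Fintype V] [Nonempty V] [Fintype G]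
    (hG : MulAction.IsPretransitive G V)
    (hb : ∀ A : Finset G, IndepFor (disagreeRel fun a : G => (a : Equiv.Perm V)) A →
      Fintype.card V * A.card ≤ Fintype.card G) (h : ISPrimitive (derangementGraph G)) :
    BalancedPrimitive (Fintype.card V) (disagreeRel fun a : G => (a : Equiv.Perm V)) := by
  classical
  rw [isPrimitive_iff _ (mul_indepNum_derangementGraph hG hb), derangementGraph_adj_eq] at h
  obtain ⟨v⟩ := ‹Nonempty V›
  refine ⟨disagreeRel_symm, hb, ?_, h⟩
  refine ⟨fun g => Fintype.equivFin V ((g : Equiv.Perm V) v), fun a b hab h => hab v ?_, ?_⟩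
  · simpa using h
  · intro i
    rw [← card_mul_card_map_eq G hG v ((Fintype.equivFin V).symm i)]
    simp [Equiv.eq_symm_apply]

/-- A maximum intersecting set exists and is a coset of a point stabilizer, of size |G|/|V|. -/
theorem StrictEKR.card_le [Fintype V] [Fintype G] (hG : MulAction.IsPretransitive G V)
    (h : StrictEKR G) (A : Finset G)
    (hA : IndepFor (disagreeRel fun a : G => (a : Equiv.Perm V)) A) :
    Fintype.card V * A.card ≤ Fintype.card G := by
  classical
  obtain ⟨S, hS, hm⟩ := exists_maximum_indepFor (disagreeRel fun a : G => (a : Equiv.Perm V))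
  obtain ⟨a, u, hau⟩ := (strictEKR_iff G (Equiv.refl G)).1 h S hS hm
  have : S = Finset.univ.filter fun g : G => (g : Equiv.Perm V) u = (a : Equiv.Perm V) u := by
    ext g
    simpa using hau g
  rw [← card_mul_card_map_eq G hG u ((a : Equiv.Perm V) u), ← this]
  exact Nat.mul_le_mul_left _ (hm A hA)

theorem strictEKR_internalDirectProduct [Fintype V] [Fintype G]
    (hV : 3 ≤ Fintype.card V) (h : StrictEKR G)
    (hP : BalancedPrimitive (Fintype.card V) (disagreeRel fun a : G => (a : Equiv.Perm V)))
    (n : ℕ) : StrictEKR (internalDirectProduct fun _ : Fin (n + 1) => G) := by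
  classical
  rw [strictEKR_internalDirectProduct_iff]
  intro S hS hm
  have hpow := hP.pow hV n
  obtain ⟨c, hc, hbal⟩ := hpow.color
  have hcard : Fintype.card V * S.card = Fintype.card (Fin (n + 1) → G) := by
    refine le_antisymm (hpow.bound S hS) ?_
    rw [← hbal ⟨0, by omega⟩]
    exact Nat.mul_le_mul_left _ (hm _ (indepFor_color hc _))
  obtain ⟨i, A, hA, hAc, hmem⟩ := hS.eq_preimage_of_card_pow_eq hV hP n hcard
  obtain ⟨a, u, hau⟩ := (strictEKR_iff G (Equiv.refl G)).1 h A hA fun T hT => by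
    have := hP.bound T hT
    rw [← hAc] at this
    exact Nat.le_of_mul_le_mul_left this (by omega)
  exact ⟨fun _ => a, i, u, fun f => by rw [hmem]; exact hau (f i)⟩

end Perm

/-! ### The "only if" direction -/

section Converse

theorem card_filter_apply_mem {ι β : Type*} [Fintype ι] [DecidableEq ι] [Fintype β]
    [DecidableEq β] (i : ι) (A : Finset β) :
    (Finset.univ.filter fun f : ι → β => f i ∈ A).card =
      A.card * Fintype.card ({j // j ≠ i} → β) := by
  rw [← Finset.card_univ, ← Finset.card_product]
  refine Finset.card_equiv (Equiv.funSplitAt i β) fun f => ?_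
  simp

variable {V : Type*} {G : Subgroup (Equiv.Perm V)}

/-- A cylinder has the same density in the power as its base has in G. -/
theorem mul_card_filter_apply_mem [Fintype G] [DecidableEq G] {n k : ℕ} (i : Fin n)
    (A : Finset G) :
    (k * A.card ≤ Fintype.card G ↔ k * (Finset.univ.filter fun f : Fin n → G => f i ∈ A).card ≤
      Fintype.card (Fin n → G)) ∧
    (k * A.card = Fintype.card G ↔ k * (Finset.univ.filter fun f : Fin n → G => f i ∈ A).card =
      Fintype.card (Fin n → G)) := by
  have hpos : 0 < Fintype.card ({j // j ≠ i} → G) := Fintype.card_pos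
  rw [card_filter_apply_mem, Fintype.card_congr (Equiv.funSplitAt i G), Fintype.card_prod,
    ← mul_assoc]
  exact ⟨(Nat.mul_le_mul_right_iff hpos).symm, (Nat.mul_left_inj hpos.ne').symm⟩

theorem IndepFor.filter_apply_mem {W : Type*} [Fintype W] [DecidableEq W] {r : W → W → Prop}
    {A : Finset W} (hA : IndepFor r A) {n : ℕ} (i : Fin n) :
    IndepFor (powRel r n) (Finset.univ.filter fun f : Fin n → W => f i ∈ A) := by
  intro f hf g hg hfg
  simp only [Finset.mem_filter, Finset.mem_univ, true_and] at hf hg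
  exact hA _ hf _ hg (hfg i)

variable [Fintype V] [Fintype G] (hG : MulAction.IsPretransitive G V)
include hG

theorem mul_card_le_of_strictEKR_internalDirectProduct {n : ℕ}
    (h : StrictEKR (internalDirectProduct fun _ : Fin n => G)) (T : Finset (Fin n → G))
    (hT : IndepFor (powRel (disagreeRel fun a : G => (a : Equiv.Perm V)) n) T) :
    Fintype.card V * T.card ≤ Fintype.card (Fin n → G) := by
  classical
  obtain ⟨S, hS, hm⟩ :=
    exists_maximum_indepFor (powRel (disagreeRel fun a : G => (a : Equiv.Perm V)) n)
  obtain ⟨f, i, v, hmem⟩ := (strictEKR_internalDirectProduct_iff G n).1 h S hS hm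
  have hSeq : S = Finset.univ.filter fun g : Fin n → G =>
      g i ∈ Finset.univ.filter fun a : G => (a : Equiv.Perm V) v = (f i : Equiv.Perm V) v := by
    ext g
    simp [hmem]
  refine (Nat.mul_le_mul_left _ (hm T hT)).trans (le_of_eq ?_)
  rw [hSeq, ← (mul_card_filter_apply_mem i _).2]
  exact card_mul_card_map_eq G hG _ _

theorem exists_coordinate_of_strictEKR_internalDirectProduct {n : ℕ}
    (h : StrictEKR (internalDirectProduct fun _ : Fin n => G)) (hV : 0 < Fintype.card V)
    {S : Finset (Fin n → G)}
    (hS : IndepFor (powRel (disagreeRel fun a : G => (a : Equiv.Perm V)) n) S)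
    (hc : Fintype.card V * S.card = Fintype.card (Fin n → G)) :
    ∃ (f : Fin n → G) (i : Fin n) (v : V), ∀ g, g ∈ S ↔
      (g i : Equiv.Perm V) v = (f i : Equiv.Perm V) v := by
  refine (strictEKR_internalDirectProduct_iff G n).1 h S hS fun T hT => ?_
  have := mul_card_le_of_strictEKR_internalDirectProduct hG h T hT
  rw [← hc] at this
  exact Nat.le_of_mul_le_mul_left this hV

theorem card_le_of_strictEKR_internalDirectProduct {n : ℕ}
    (h : StrictEKR (internalDirectProduct fun _ : Fin (n + 1) => G)) (A : Finset G)
    (hA : IndepFor (disagreeRel fun a : G => (a : Equiv.Perm V)) A) :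
    Fintype.card V * A.card ≤ Fintype.card G := by
  classical
  exact (mul_card_filter_apply_mem (n := n + 1) 0 A).1.2
    (mul_card_le_of_strictEKR_internalDirectProduct hG h _ (hA.filter_apply_mem 0))

theorem strictEKR_of_internalDirectProduct [Nonempty V] {n : ℕ}
    (h : StrictEKR (internalDirectProduct fun _ : Fin (n + 1) => G)) : StrictEKR G := by
  classical
  rw [strictEKR_iff G (Equiv.refl G)]
  intro A hA hm
  obtain ⟨v₀⟩ := ‹Nonempty V›
  have hAc : Fintype.card V * A.card = Fintype.card G := by
    refine le_antisymm (card_le_of_strictEKR_internalDirectProduct hG h A hA) ?_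
    rw [← card_mul_card_map_eq G hG v₀ v₀]
    exact Nat.mul_le_mul_left _ (hm _ (indepFor_map_eq v₀ v₀))
  obtain ⟨f, i, v, hmem⟩ := exists_coordinate_of_strictEKR_internalDirectProduct hG h
    Fintype.card_pos (IndepFor.filter_apply_mem (n := n + 1) hA 0)
    ((mul_card_filter_apply_mem (n := n + 1) 0 A).2.1 hAc)
  -- On constant tuples the cylinder over `A` tests membership in `A`, whichever coordinate i was
  -- found.
  exact ⟨f i, v, fun b => by simpa using hmem fun _ => b⟩

/-- A set violating IS-primitivity gives a maximum independent set of a direct power that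
depends on two coordinates. -/
theorem card_eq_of_strictEKR_internalDirectProduct (hV : 2 ≤ Fintype.card V) {n : ℕ}
    (h : StrictEKR (internalDirectProduct fun _ : Fin (n + 2) => G)) {A : Finset G}
    (hA : IndepFor (disagreeRel fun a : G => (a : Equiv.Perm V)) A) (hne : A.Nonempty)
    (hN : Fintype.card V * A.card =
      (closedNbhd (disagreeRel fun a : G => (a : Equiv.Perm V)) A).card) :
    Fintype.card V * A.card = Fintype.card G := by
  classical
  by_contra hlt
  obtain ⟨v₀, v₁, hv⟩ := Fintype.one_lt_card_iff.1 hV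
  obtain ⟨N, hNdef⟩ : ∃ N, N = closedNbhd (disagreeRel fun a : G => (a : Equiv.Perm V)) A :=
    ⟨_, rfl⟩
  rw [← hNdef] at hN
  obtain ⟨T, hT⟩ : ∃ T : Finset G, T =
    Finset.univ.filter fun g : G => (g : Equiv.Perm V) v₀ = v₀ := ⟨_, rfl⟩
  have hTi : IndepFor (disagreeRel fun a : G => (a : Equiv.Perm V)) T :=
    hT ▸ indepFor_map_eq v₀ v₀
  have hTc : Fintype.card V * T.card = Fintype.card G := hT ▸ card_mul_card_map_eq G hG v₀ v₀
  have hmT : ∀ g : G, g ∈ T ↔ (g : Equiv.Perm V) v₀ = v₀ := by simp [hT]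
  -- Coordinate 0 decides inside `N[A]`; outside it, coordinate 1 decides through `T`.
  let P : Finset (G × (Fin (n + 1) → G)) := A ×ˢ Finset.univ ∪
    Nᶜ ×ˢ (Finset.univ.filter fun f : Fin (n + 1) → G => f 0 ∈ T)
  let S : Finset (Fin (n + 2) → G) := P.map (Fin.consEquiv fun _ => G).toEmbedding
  have hmS : ∀ g : Fin (n + 2) → G, g ∈ S ↔ g 0 ∈ A ∨ g 0 ∉ N ∧ g 1 ∈ T := by
    intro g
    simp only [S, P, Finset.mem_map_equiv]
    simp [Fin.consEquiv, Fin.tail]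
  have hS : IndepFor (powRel (disagreeRel fun a : G => (a : Equiv.Perm V)) (n + 2)) S := by
    intro f hf g hg hfg
    rw [hmS] at hf hg
    rcases hf with hf | hf <;> rcases hg with hg | hg
    · exact hA _ hf _ hg (hfg 0)
    · exact hg.1 (hNdef ▸ mem_closedNbhd.2 (Or.inr ⟨_, hf, hfg 0⟩))
    · exact hf.1 (hNdef ▸ mem_closedNbhd.2 (Or.inr ⟨_, hg, disagreeRel_symm _ _ (hfg 0)⟩))
    · exact hTi _ hf.2 _ hg.2 (hfg 1)
  -- The first piece contributes k|A| = |N| times |G|^(n+1), the second |Nᶜ| times |G|^(n+1), which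
  -- add up to the whole.
  have hSc : Fintype.card V * S.card = Fintype.card (Fin (n + 2) → G) := by
    have hd : Disjoint (A ×ˢ (Finset.univ : Finset (Fin (n + 1) → G)))
        (Nᶜ ×ˢ (Finset.univ.filter fun f : Fin (n + 1) → G => f 0 ∈ T)) := by
      rw [Finset.disjoint_product]
      left
      rw [Finset.disjoint_left]
      intro a ha ha'
      exact Finset.mem_compl.1 ha' (hNdef ▸ subset_closedNbhd A ha)
    have h1 := (mul_card_filter_apply_mem (n := n + 1) 0 T).2.1 hTc
    have h2 : Nᶜ.card + N.card = Fintype.card G := Finset.card_compl_add_card N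
    rw [Finset.card_map, Finset.card_union_of_disjoint hd, Finset.card_product,
      Finset.card_product, mul_add, mul_left_comm _ Nᶜ.card, h1, Finset.card_univ, ← mul_assoc,
      hN, ← add_mul, add_comm, h2, ← Fintype.card_prod]
    exact Fintype.card_congr (Fin.consEquiv fun _ => G)
  obtain ⟨f, i, v, hmem⟩ :=
    exists_coordinate_of_strictEKR_internalDirectProduct hG h (by omega) hS hSc
  obtain ⟨a, ha⟩ := hne
  have haN : a ∈ N := hNdef ▸ subset_closedNbhd A ha
  obtain ⟨b, hb⟩ : ∃ b, b ∉ N := by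
    by_contra! hall
    exact hlt (hN.trans (by rw [Finset.eq_univ_of_forall hall, Finset.card_univ]))
  have hbA : b ∉ A := fun hbA => hb (hNdef ▸ subset_closedNbhd A hbA)
  obtain ⟨x, hx⟩ := hG.exists_smul_eq v₀ v₁
  have hxT : x ∉ T := by
    rw [hmT]
    intro h
    exact hv (h.symm.trans hx)
  have h1T : (1 : G) ∈ T := by simp [hmT]
  -- With b ∉ N in coordinate 0, membership changes with coordinate 1, so i ≠ 0. With a ∈ A there,
  -- every tuple belongs, so i > 0 would make all of G send v to one point, against transitivity.
  induction i using Fin.cases with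
  | zero =>
    have m1 := (hmS (Fin.cons b fun _ => 1)).2 (Or.inr ⟨hb, h1T⟩)
    have m2 : (Fin.cons b fun _ => x : Fin (n + 2) → G) ∉ S := by
      rw [hmS]
      rintro (h | h)
      · exact hbA h
      · exact hxT h.2
    have m3 := (hmem _).1 m1
    exact m2 ((hmem _).2 m3)
  | succ j =>
    have m : ∀ g : G, (g : Equiv.Perm V) v = (f j.succ : Equiv.Perm V) v := by
      intro g
      exact (hmem (Fin.cons a fun _ => g)).1 ((hmS _).2 (Or.inl ha))
    obtain ⟨g₀, hg₀⟩ := hG.exists_smul_eq v v₀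
    obtain ⟨g₁, hg₁⟩ := hG.exists_smul_eq v v₁
    exact hv (hg₀.symm.trans ((m g₀).trans ((m g₁).symm.trans hg₁)))

end Converse

theorem mainTheorem4 {V : Type*} [Finite V] (G : Subgroup (Equiv.Perm V))
    (hG : MulAction.IsPretransitive G V) (hV : 3 ≤ Nat.card V) (n : ℕ) (hn : 2 ≤ n) :
    StrictEKR (internalDirectProduct (fun _ : Fin n => G)) ↔
      StrictEKR G ∧ ISPrimitive (derangementGraph G) := by
  classical
  have := Fintype.ofFinite V
  have := Fintype.ofFinite G
  rw [Nat.card_eq_fintype_card] at hV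
  have : Nonempty V := Fintype.card_pos_iff.1 (by omega)
  obtain ⟨m, rfl⟩ : ∃ m, n = m + 2 := ⟨n - 2, by omega⟩
  constructor
  · intro h
    have hE := strictEKR_of_internalDirectProduct hG h
    refine ⟨hE, ?_⟩
    rw [isPrimitive_iff _ (mul_indepNum_derangementGraph hG (hE.card_le hG)),
      derangementGraph_adj_eq]
    exact fun A hA hne hN => card_eq_of_strictEKR_internalDirectProduct hG (by omega) h hA hne hN
  · rintro ⟨hE, hI⟩
    exact strictEKR_internalDirectProduct hV hE
      (hI.balancedPrimitive hG (hE.card_le hG)) (m + 1)
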